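/- Let $\varphi_0(\alpha)=\omega^\alpha$ and, for $m\in\mathbb N$, let $\varphi_{m+1}$ be the function enumerating in increasing order the fixed points of $\varphi_m$ (the finite Veblen functions on ordinals); $\varphi_0^k$ is the $k$-fold iterate of $\varphi_0$, and $\mathsf{ot}(S)$ is the order type of a well-ordered set $S$. A function $g\colon\mathbb R^n\to\mathbb R$ is monotone if $g(\vec x)\le g(\vec y)$ whenever $x_i\le y_i$ for all $i$. For $g\colon\mathbb R^n\to\mathbb R$ let $\mathcal F(\{g\},\{0\})$ be the inclusion-least set $\mathcal F\subseteq\mathbb R$ such that $0\in\mathcal F$, and such that $g(x_1,\dots,x_n)\in\mathcal F$ whenever $x_1,\dots,x_n\in\mathcal F$ and $g(x_1,\dots,x_n)>\max_i x_i$. For $f\colon\mathbb R\to\mathbb R$ let $A(f)\subseteq\mathbb R\cup\{+\infty\}$ be the set of all limits $\lim_{i\to\infty}f^i(x)$ that exist in $\mathbb R\cup\{+\infty\}$, where $x\in\mathbb R$ and $f(x)>x$ (for monotone $f$ these limits always exist). For $u\subseteq\{1,\dots,n\}$ and $\vec p\in\mathbb R^{\{1,\dots,n\}\setminus u}$ let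 $\dot g_{u,\vec p}\colon\mathbb R\to\mathbb R$ be the function that maps $x$ to $g(y_1,\dots,y_n)$, where $y_j=x$ for $j\in u$ and $y_j=p_j$ for $j\notin u$. For $P\subseteq\mathbb R$ put $A(\dot g_u,P)=\bigcup_{\vec p\in P^{\{1,\dots,n\}\setminus u}}A(\dot g_{u,\vec p})$. A monotone function $g\colon\mathbb R^n\to\mathbb R$ is called tame if there is $k\in\mathbb N$ such that for every $u\subsetneq\{1,\dots,n\}$, every well-ordered $P\subseteq\mathbb R$ and every well-ordered $B\subseteq A(\dot g_u,P)$, $$\mathsf{ot}(B)<\varphi_0^k(\mathsf{ot}(P)+1).$$ **Theorem.** (1) If $n\ge 2$ and $g\colon\mathbb R^n\to\mathbb R$ is monotone and tame, then $\mathcal F(\{g\},\{0\})$ is well-ordered and $\mathsf{ot}(\mathcal F(\{g\},\{0\}))\le\varphi_{n-1}(0)$. (2) For all $\alpha_1,\dots,\alpha_n\ge 0$ and $C\in\mathbb R$, the function $g(x_1,\dots,x_n)=\alpha_1x_1+\dots+\alpha_nx_n+C$ is monotone and tame. -/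

import Mathlib

open Filter Topology

namespace MonotoneGeneration

/-- Membership in the set generated from the constants `P` by the finitary functions in `G`:
a value `g x` is added whenever all entries of `x` have been generated and `g x` is strictly
greater than each of them. A member of `G` is an arity together with a function of that arity. -/
inductive Generated (G : Set (Σ k : ℕ, (Fin k → ℝ) → ℝ)) (P : Set ℝ) : ℝ → Prop
  | const {x : ℝ} (hx : x ∈ P) : Generated G P x
  | app {k : ℕ} {g : (Fin k → ℝ) → ℝ} (hg : (⟨k, g⟩ : Σ k : ℕ, (Fin k → ℝ) → ℝ) ∈ G)
      (x : Fin k → ℝ) (hx : ∀ i, Generated G P (x i)) (hlt : ∀ i, x i < g x) :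
      Generated G P (g x)

/-- The set `F(G, P)`. -/
def generatedSet (G : Set (Σ k : ℕ, (Fin k → ℝ) → ℝ)) (P : Set ℝ) : Set ℝ :=
  {x | Generated G P x}

/-- The order type of a well-ordered subset of a linear order. -/
noncomputable def ot {α : Type*} [LinearOrder α] (s : Set α) [WellFoundedLT s] : Ordinal :=
  Ordinal.type (fun x y : s => x < y)

/-- The set `A(f)` of limits, in the extended reals, of the iterates `f^[i] x` at those points
`x` with `f x > x`. -/
def limitPoints (f : ℝ → ℝ) : Set EReal :=
  {a | ∃ x : ℝ, x < f x ∧ Tendsto (fun i : ℕ => ((f^[i] x : ℝ) : EReal)) atTop (𝓝 a)}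

/-- The set `A(h; P)`, the union of `A(h p)` over all parameter vectors `p` with entries
in `P`. -/
def familyLimitPoints {ι : Type*} (h : (ι → ℝ) → ℝ → ℝ) (P : Set ℝ) : Set EReal :=
  {a | ∃ p : ι → ℝ, (∀ i, p i ∈ P) ∧ a ∈ limitPoints (h p)}

/-- The function `g_{u,p}`: the parameters `p` are substituted for the arguments of `g` with
indices outside `u`. -/
def restrict {n : ℕ} (g : (Fin n → ℝ) → ℝ) (u : Finset (Fin n)) (p : {i // i ∉ u} → ℝ)
    (x : {i // i ∈ u} → ℝ) : ℝ :=
  g fun i => if h : i ∈ u then x ⟨i, h⟩ else p ⟨i, h⟩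

/-- The diagonal restriction: `g_{u,p}` with all remaining arguments equal to `t`. -/
def diagRestrict {n : ℕ} (g : (Fin n → ℝ) → ℝ) (u : Finset (Fin n)) (p : {i // i ∉ u} → ℝ)
    (t : ℝ) : ℝ :=
  restrict g u p fun _ => t

/-- Tameness of a function `g` (used for monotone `g`). Here `Ordinal.veblen 0` is the function
`φ_0(α) = ω ^ α`, and it is iterated `k` times. -/
def IsTame {n : ℕ} (g : (Fin n → ℝ) → ℝ) : Prop :=
  ∃ k : ℕ, ∀ u : Finset (Fin n), u ⊂ Finset.univ →
    ∀ (P : Set ℝ) [WellFoundedLT P] (B : Set EReal) [WellFoundedLT B],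
      B ⊆ familyLimitPoints (diagRestrict g u) P →
        ot B < (Ordinal.veblen 0)^[k] (ot P + 1)

end MonotoneGeneration

namespace MonotoneGeneration

open Ordinal

/-! ### Natural sums of finite families of ordinals -/

/-! The proof counts how many arguments of an application may be newly generated: `PartialGen g Q m`
allows at most m outside the constants Q, and each further argument costs one Veblen level. With m +
1 new arguments the bound is a finite iterate of φ_m (`exists_bound_partialGenSet`).

Suppose no limit of iterates of a diagonal restriction of arity m + 1 lies in (y₀, c], for generated
y₀ < c. By `exists_threshold` there is y < c such that every application with m + 1 new arguments
and value in (y, c) has one of them at most y. Turning the generated elements up to y into constants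
leaves m new arguments, for which induction gives an iterate of φ_{m-1}; values of φ_m are closed
under it. So the next value of φ_m can be reached only at a limit point, and tameness bounds the
order type of the limit points (`orderTypeLE_of_step`). With one new argument there is nothing left
to iterate: beyond y one evaluates g on a product of known sets, and `OrderTypeLE.image_pi` bounds
the result by natural sums of exponents.

When all n arguments are new, tameness is silent but not needed: iterates of the full diagonal pass
every generated element (`PartialGen.exists_le_iterate`), so proper initial segments never reach
φ_{n-1}(0).

For linear g the finite limits are b / (1 - A), where A is the slope of the diagonal restriction and
b is monotone in the parameters, so `OrderTypeLE.image_pi` applies again. -/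

theorem small_setOf_lt {ι : Type} (a : ι → Ordinal.{0}) : Small.{0} {b : ι → Ordinal.{0} // b < a} := by
  let φ : {b : ι → Ordinal.{0} // b < a} → (∀ i, Set.Iic (a i)) := fun b i => ⟨b.1 i, b.2.le i⟩
  refine small_of_injective (f := φ) ?_
  intro b c h
  apply Subtype.ext
  funext i
  exact congrArg Subtype.val (congrFun h i)

/-- The natural (Hessenberg) sum of a finite family of ordinals: the least ordinal-valued function
that is strictly increasing in the product order. -/
noncomputable def naturalSum {ι : Type} [Finite ι] (a : ι → Ordinal.{0}) : Ordinal.{0} :=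
  wellFounded_lt.fix (C := fun _ => Ordinal.{0}) (fun a F => ⨆ b : {b : ι → Ordinal.{0} // b < a}, (F b.1 b.2 + 1)) a

variable {ι : Type} [Finite ι]

theorem naturalSum_eq (a : ι → Ordinal.{0}) :
    naturalSum a = ⨆ b : {b : ι → Ordinal.{0} // b < a}, (naturalSum b.1 + 1) := by
  rw [naturalSum, WellFounded.fix_eq]
  rfl

theorem naturalSum_strictMono : StrictMono (naturalSum : (ι → Ordinal.{0}) → Ordinal.{0}) := by
  intro b a h
  rw [naturalSum_eq a]
  have := small_setOf_lt a
  have := Ordinal.le_iSup (fun b : {b : ι → Ordinal.{0} // b < a} => naturalSum b.1 + 1) ⟨b, h⟩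
  exact (lt_add_one _).trans_le this

theorem naturalSum_le_iff {a : ι → Ordinal.{0}} {o : Ordinal.{0}} :
    naturalSum a ≤ o ↔ ∀ b < a, naturalSum b < o := by
  refine ⟨fun h b hb => (naturalSum_strictMono hb).trans_le h, fun h => ?_⟩
  rw [naturalSum_eq a]
  exact ciSup_le' fun b => Order.add_one_le_of_lt (h b.1 b.2)

theorem naturalSum_lt_omega0_opow {δ : Ordinal.{0}} {a : ι → Ordinal.{0}}
    (h : ∀ i, a i < ω ^ δ) : naturalSum a < ω ^ δ := by
  induction δ using WellFoundedLT.induction generalizing a with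
  | ind δ ih =>
  have := Fintype.ofFinite ι
  rcases eq_or_ne δ 0 with rfl | hδ
  · have ha : a = 0 := by
      funext i
      simpa using h i
    have : naturalSum a ≤ 0 := by
      rw [naturalSum_le_iff]
      intro b hb
      rw [ha] at hb
      exact absurd hb (not_lt_of_ge fun i => zero_le)
    exact this.trans_lt (by simp)
  obtain ⟨ε, hε, N, hN⟩ : ∃ ε < δ, ∃ N : ℕ, ∀ i, a i < ω ^ ε * N := by
    have h1 := fun i => (lt_omega0_opow hδ).1 (h i)
    choose c hc n hn using h1
    rcases isEmpty_or_nonempty ι with hι | hι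
    · exact ⟨0, pos_iff_ne_zero.2 hδ, 0, fun i => hι.elim i⟩
    obtain ⟨i0, hi0⟩ := Finite.exists_max c
    obtain ⟨j0, hj0⟩ := Finite.exists_max n
    refine ⟨c i0, hc i0, n j0, fun i => (hn i).trans_le ?_⟩
    exact mul_le_mul' (Ordinal.opow_le_opow_right omega0_pos (hi0 i)) (Nat.cast_le.2 (hj0 i))
  have hw : (ω ^ ε : Ordinal.{0}) ≠ 0 := opow_ne_zero _ omega0_ne_zero
  -- Split off the leading coefficients at ω ^ ε. Decreasing b lowers either a remainder or the sum
  -- of the coefficients, and in the latter case the outer induction keeps the remainder's natural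
  -- sum below ω ^ ε.
  have key : ∀ b : ι → Ordinal.{0}, ∀ k : ι → ℕ, ∀ r : ι → Ordinal.{0}, (∀ i, r i < ω ^ ε) →
      (∀ i, b i = ω ^ ε * k i + r i) →
      naturalSum b ≤ ω ^ ε * ((∑ i, k i : ℕ) : Ordinal) + naturalSum r := by
    intro b
    induction b using WellFoundedLT.induction with
    | ind b ihb =>
    intro k r hr hb
    rw [naturalSum_le_iff]
    intro c hc
    have hk' : ∀ i, ∃ l : ℕ, l ≤ k i ∧ c i / ω ^ ε = l := by
      intro i
      have h1 : c i / ω ^ ε ≤ k i := by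
        rw [← Order.lt_add_one_iff, ← Ordinal.lt_mul_iff_div_lt hw]
        refine (hc.le i).trans_lt ?_
        rw [hb i, mul_add_one]
        exact (add_lt_add_iff_left _).2 (hr i)
      obtain ⟨l, hl⟩ := lt_omega0.1 (h1.trans_lt (natCast_lt_omega0 _))
      exact ⟨l, by rw [hl] at h1; exact_mod_cast h1, hl⟩
    choose l hl hcl using hk'
    have hs : ∀ i, c i % ω ^ ε < ω ^ ε := fun i => mod_lt _ hw
    have hceq : ∀ i, c i = ω ^ ε * l i + c i % ω ^ ε := fun i => by
      rw [← hcl i]; exact (div_add_mod _ _).symm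
    refine (ihb c hc l _ hs hceq).trans_lt ?_
    by_cases hlk : l = k
    · subst hlk
      refine (add_lt_add_iff_left _).2 (naturalSum_strictMono ?_)
      rw [Pi.lt_def] at hc ⊢
      obtain ⟨h1, i, h2⟩ := hc
      refine ⟨fun j => ?_, i, ?_⟩
      · have := h1 j
        rw [hb j, hceq j] at this
        exact (add_le_add_iff_left _).1 this
      · rw [hb i, hceq i] at h2
        exact (add_lt_add_iff_left _).1 h2
    · have hlt : ∑ i, l i < ∑ i, k i := by
        obtain ⟨i, hi⟩ := Function.ne_iff.1 hlk
        exact Finset.sum_lt_sum (fun j _ => hl j) ⟨i, Finset.mem_univ _, lt_of_le_of_ne (hl i) hi⟩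
      calc ω ^ ε * ((∑ i, l i : ℕ) : Ordinal) + naturalSum (fun i => c i % ω ^ ε)
          < ω ^ ε * ((∑ i, l i : ℕ) : Ordinal) + ω ^ ε := (add_lt_add_iff_left _).2 (ih ε hε hs)
        _ = ω ^ ε * ((∑ i, l i + 1 : ℕ) : Ordinal) := by rw [Nat.cast_add_one, mul_add_one]
        _ ≤ ω ^ ε * ((∑ i, k i : ℕ) : Ordinal) := mul_le_mul' le_rfl (Nat.cast_le.2 hlt)
        _ ≤ _ := le_add_right le_rfl
  have hk : ∀ i, ∃ l : ℕ, a i / ω ^ ε = l := fun i =>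
    lt_omega0.1 (((Ordinal.lt_mul_iff_div_lt hw).1 (hN i)).trans (natCast_lt_omega0 _))
  choose l hl using hk
  refine (key a l (fun i => a i % ω ^ ε) (fun i => mod_lt _ hw) (fun i => ?_)).trans_lt ?_
  · rw [← hl i]; exact (div_add_mod _ _).symm
  · refine (isPrincipal_add_omega0_opow δ) ?_ ?_
    · exact opow_mul_lt_opow (natCast_lt_omega0 _) hε
    · exact (ih ε hε fun i => mod_lt _ hw).trans
        ((Ordinal.opow_lt_opow_iff_right one_lt_omega0).2 hε)

/-! ### Upper bounds for order types -/

/-- The set `s` is well-ordered, of order type at most `o`. -/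
def OrderTypeLE {α : Type} [LinearOrder α] (s : Set α) (o : Ordinal.{0}) : Prop :=
  ∃ f : α → Ordinal.{0}, StrictMonoOn f s ∧ ∀ x ∈ s, f x < o

/-- The set `s` is well-ordered, of order type less than `o`. -/
def OrderTypeLT {α : Type} [LinearOrder α] (s : Set α) (o : Ordinal.{0}) : Prop :=
  ∃ o' < o, OrderTypeLE s o'

section OrderType

variable {α : Type} [LinearOrder α] {s t : Set α} {o o' : Ordinal.{0}}

theorem OrderTypeLE.mono (h : OrderTypeLE s o) (hs : t ⊆ s) (ho : o ≤ o') : OrderTypeLE t o' := by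
  obtain ⟨f, hf, hfo⟩ := h
  exact ⟨f, hf.mono hs, fun x hx => (hfo x (hs hx)).trans_le ho⟩

theorem OrderTypeLT.mono (h : OrderTypeLT s o) (hs : t ⊆ s) (ho : o ≤ o') : OrderTypeLT t o' := by
  obtain ⟨p, hp, hf⟩ := h
  exact ⟨p, hp.trans_le ho, hf.mono hs le_rfl⟩

theorem OrderTypeLT.le (h : OrderTypeLT s o) : OrderTypeLE s o := by
  obtain ⟨p, hp, hf⟩ := h
  exact hf.mono le_rfl hp.le

theorem orderTypeLE_empty (o : Ordinal.{0}) : OrderTypeLE (∅ : Set α) o :=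
  ⟨fun _ => 0, by simp [StrictMonoOn], by simp⟩

theorem OrderTypeLE.eq_empty (h : OrderTypeLE s 0) : s = ∅ := by
  obtain ⟨f, -, hf⟩ := h
  exact Set.eq_empty_of_forall_notMem fun x hx => not_lt_zero (hf x hx)

/-- Reduces every later bound to proper initial segments; the rank of x is the least bound for the
part of s below x. -/
theorem orderTypeLE_iff : OrderTypeLE s o ↔ ∀ x ∈ s, OrderTypeLT (s ∩ Set.Iio x) o := by
  constructor
  · rintro ⟨f, hf, hfo⟩ x hx
    exact ⟨f x, hfo x hx, f, hf.mono Set.inter_subset_left, fun y hy => hf hy.1 hx hy.2⟩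
  · intro h
    let f : α → Ordinal.{0} := fun x => sInf {p | OrderTypeLE (s ∩ Set.Iio x) p}
    have hle : ∀ {x p}, OrderTypeLE (s ∩ Set.Iio x) p → f x ≤ p := fun {x p} hp =>
      csInf_le' (s := {p | OrderTypeLE (s ∩ Set.Iio x) p}) hp
    have hmem : ∀ x ∈ s, OrderTypeLE (s ∩ Set.Iio x) (f x) := fun x hx => by
      obtain ⟨p, -, hp⟩ := h x hx
      exact csInf_mem (s := {p | OrderTypeLE (s ∩ Set.Iio x) p}) ⟨p, hp⟩
    refine ⟨f, fun x hx y hy hxy => ?_, fun x hx => ?_⟩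
    · obtain ⟨g, hg, hgo⟩ := hmem y hy
      refine (hle ⟨g, hg.mono ?_, fun z hz => ?_⟩).trans_lt (hgo x ⟨hx, hxy⟩)
      · exact fun z hz => ⟨hz.1, hz.2.trans hxy⟩
      · exact hg ⟨hz.1, hz.2.trans hxy⟩ ⟨hx, hxy⟩ hz.2
    · obtain ⟨p, hp, hpf⟩ := h x hx
      exact (hle hpf).trans_lt hp

theorem OrderTypeLE.isWF (h : OrderTypeLE s o) : s.IsWF := by
  obtain ⟨f, hf, -⟩ := h
  rw [Set.IsWF, Set.WellFoundedOn]
  exact Subrelation.wf (fun {a b} (hab : a.1 < b.1) => hf a.2 b.2 hab)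
    (InvImage.wf (fun x : s => f x.1) (wellFounded_lt (α := Ordinal.{0})))

theorem OrderTypeLE.wellFoundedLT (h : OrderTypeLE s o) : WellFoundedLT s :=
  ⟨h.isWF⟩

theorem OrderTypeLE.ot_le [WellFoundedLT s] (h : OrderTypeLE s o) : ot s ≤ o := by
  obtain ⟨f, hf, hfo⟩ := h
  have key : ∀ x : s, Ordinal.typein (fun x y : s => x < y) x ≤ f x := by
    intro x
    induction x using WellFoundedLT.induction with
    | ind x ih =>
    refine le_of_forall_lt fun p hp => ?_
    obtain ⟨y, rfl⟩ := Ordinal.typein_surj (fun x y : s => x < y)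
      (hp.trans (Ordinal.typein_lt_type _ x))
    have hyx : y < x := (Ordinal.typein_lt_typein (fun x y : s => x < y)).1 hp
    exact (ih y hyx).trans_lt (hf y.2 x.2 hyx)
  refine le_of_forall_lt fun p hp => ?_
  obtain ⟨y, rfl⟩ := Ordinal.typein_surj (fun x y : s => x < y) hp
  exact (key y).trans_lt (hfo y y.2)

theorem orderTypeLE_ot [WellFoundedLT s] : OrderTypeLE s (ot s) := by
  classical
  refine ⟨fun x => if h : x ∈ s then Ordinal.typein (fun x y : s => x < y) ⟨x, h⟩ else 0, ?_, ?_⟩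
  · intro x hx y hy hxy
    simp only [hx, hy, dif_pos]
    exact (Ordinal.typein_lt_typein (fun x y : s => x < y)).2 hxy
  · intro x hx
    simp only [hx, dif_pos]
    exact Ordinal.typein_lt_type _ _

theorem orderTypeLE_singleton (x : α) : OrderTypeLE {x} 1 :=
  ⟨fun _ => 0, by simp [StrictMonoOn], by simp⟩

theorem OrderTypeLE.Iic {y : α} (h : OrderTypeLE (s ∩ Set.Iio y) o) :
    OrderTypeLE (s ∩ Set.Iic y) (o + 1) := by
  rw [orderTypeLE_iff]
  intro x hx
  refine ⟨o, lt_add_one o, h.mono ?_ le_rfl⟩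
  exact fun z hz => ⟨hz.1.1, lt_of_lt_of_le hz.2 hx.2⟩

/-- Cutting at a point of some S i strictly lowers the i-th bound and raises no other, so the
natural sum drops. -/
theorem OrderTypeLE.iUnion {S : ι → Set α} {a : ι → Ordinal.{0}}
    (h : ∀ i, OrderTypeLE (S i) (a i)) : OrderTypeLE (⋃ i, S i) (naturalSum a) := by
  induction a using WellFoundedLT.induction generalizing S with
  | ind a ih =>
  classical
  rw [orderTypeLE_iff]
  intro x hx
  obtain ⟨i, hi⟩ := Set.mem_iUnion.1 hx
  obtain ⟨p, hp, hpS⟩ := orderTypeLE_iff.1 (h i) x hi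
  have hlt : Function.update a i p < a := by
    simpa [update_lt_self_iff] using hp
  refine ⟨_, naturalSum_strictMono hlt, ?_⟩
  rw [Set.iUnion_inter]
  refine ih _ hlt fun j => ?_
  rcases eq_or_ne j i with rfl | hj
  · simpa using hpS
  · rw [Function.update_of_ne hj]
    exact (h j).mono Set.inter_subset_left le_rfl

theorem OrderTypeLT.iUnion {S : ι → Set α} {δ : Ordinal.{0}}
    (h : ∀ i, OrderTypeLT (S i) (ω ^ δ)) : OrderTypeLT (⋃ i, S i) (ω ^ δ) := by
  choose a ha hS using h
  exact ⟨_, naturalSum_lt_omega0_opow ha, OrderTypeLE.iUnion hS⟩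

theorem OrderTypeLT.union {δ : Ordinal.{0}} (hs : OrderTypeLT s (ω ^ δ))
    (ht : OrderTypeLT t (ω ^ δ)) : OrderTypeLT (s ∪ t) (ω ^ δ) := by
  rw [Set.union_eq_iUnion]
  exact OrderTypeLT.iUnion fun b => by cases b <;> assumption

theorem OrderTypeLE.exists_union_eq {p q : Ordinal.{0}} (h : OrderTypeLE s (p + q)) :
    ∃ t u : Set α, s = t ∪ u ∧ OrderTypeLE t p ∧ OrderTypeLE u q := by
  obtain ⟨f, hf, hfo⟩ := h
  refine ⟨{x ∈ s | f x < p}, {x ∈ s | p ≤ f x}, ?_, ⟨f, hf.mono (Set.sep_subset _ _), fun x hx => hx.2⟩,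
    fun x => f x - p, ?_, ?_⟩
  · ext x
    simp only [Set.mem_union, Set.mem_ofPred_eq, ← and_or_left, lt_or_ge, and_true]
  · intro x hx y hy hxy
    have := hf hx.1 hy.1 hxy
    rw [← Ordinal.add_sub_cancel_of_le hx.2, ← Ordinal.add_sub_cancel_of_le hy.2] at this
    exact (add_lt_add_iff_left _).1 this
  · intro x hx
    have := hfo x hx.1
    rw [← Ordinal.add_sub_cancel_of_le hx.2] at this
    exact (add_lt_add_iff_left _).1 this

/-- An induction principle for the sets of order type less than a power of `ω`. -/
theorem OrderTypeLT.induction {δ : Ordinal.{0}} {motive : Set α → Prop} (empty : motive ∅)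
    (union : ∀ s t, motive s → motive t → motive (s ∪ t))
    (opow : ∀ ε < δ, ∀ s, OrderTypeLE s (ω ^ ε) → motive s)
    (h : OrderTypeLT s (ω ^ δ)) : motive s := by
  obtain ⟨o, ho, hs⟩ := h
  rcases eq_or_ne δ 0 with rfl | hδ
  · rw [opow_zero, Order.lt_one_iff] at ho
    subst ho
    rwa [hs.eq_empty]
  obtain ⟨ε, hε, n, hn⟩ := (lt_omega0_opow hδ).1 ho
  replace hs := hs.mono le_rfl hn.le
  clear hn ho
  induction n generalizing s with
  | zero =>
    rw [Nat.cast_zero, mul_zero] at hs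
    rwa [hs.eq_empty]
  | succ n ih =>
    rw [Nat.cast_add_one, mul_add_one] at hs
    obtain ⟨t, u, rfl, ht, hu⟩ := hs.exists_union_eq
    exact union t u (ih ht) (opow ε hε u hu)

end OrderType

/-- The image of a product of well-ordered sets under a monotone function. -/
theorem OrderTypeLE.image_pi {α β : Type} [LinearOrder α] [LinearOrder β]
    {g : (ι → α) → β} (hg : Monotone g) {S : ι → Set α} {a : ι → Ordinal.{0}}
    (h : ∀ i, OrderTypeLE (S i) (ω ^ a i)) :
    OrderTypeLE (g '' {x | ∀ i, x i ∈ S i}) (ω ^ naturalSum a) := by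
  induction a using WellFoundedLT.induction generalizing S with
  | ind a ih =>
  classical
  rw [orderTypeLE_iff]
  rintro _ ⟨x, hx, rfl⟩
  -- Shrinking the i-th factor to X cuts it into finitely many pieces of type at most ω ^ ε with ε <
  -- a i. The induction hypothesis handles each, and powers of ω absorb finite unions.
  have key : ∀ i X, OrderTypeLT X (ω ^ a i) →
      OrderTypeLT (g '' {y | ∀ j, y j ∈ Function.update S i X j}) (ω ^ naturalSum a) := by
    intro i X hX
    refine OrderTypeLT.induction (motive := fun X =>
      OrderTypeLT (g '' {y | ∀ j, y j ∈ Function.update S i X j}) (ω ^ naturalSum a))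
      ?_ ?_ ?_ hX
    · refine ⟨0, opow_pos _ omega0_pos, ?_⟩
      convert orderTypeLE_empty (α := β) 0
      rw [Set.image_eq_empty]
      refine Set.eq_empty_of_forall_notMem fun y hy => ?_
      simpa using hy i
    · intro s t hs ht
      refine (hs.union ht).mono ?_ le_rfl
      rw [← Set.image_union]
      refine Set.image_mono fun y hy => ?_
      have hyi := hy i
      rw [Function.update_self] at hyi
      rcases hyi with hyi | hyi
      · left
        intro j
        rcases eq_or_ne j i with rfl | hj
        · simpa using hyi
        · simpa [hj] using hy j
      · right
        intro j
        rcases eq_or_ne j i with rfl | hj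
        · simpa using hyi
        · simpa [hj] using hy j
    · intro ε hε s hs
      have hlt : Function.update a i ε < a := by
        simpa [update_lt_self_iff] using hε
      refine ⟨_, (Ordinal.opow_lt_opow_iff_right one_lt_omega0).2 (naturalSum_strictMono hlt),
        ih _ hlt fun j => ?_⟩
      rcases eq_or_ne j i with rfl | hj
      · simpa using hs
      · simpa [hj] using h j
  refine (OrderTypeLT.iUnion fun i => key i _ (orderTypeLE_iff.1 (h i) (x i) (hx i))).mono ?_ le_rfl
  rintro _ ⟨⟨y, hy, rfl⟩, hyx⟩
  -- By monotonicity a value below g x has some coordinate below that of x, so finitely many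
  -- shrunken products cover the initial segment.
  obtain ⟨i, hi⟩ : ∃ i, y i < x i := by
    by_contra! hcon
    exact absurd (hg hcon) (not_le.2 hyx)
  refine Set.mem_iUnion.2 ⟨i, y, fun j => ?_, rfl⟩
  rcases eq_or_ne j i with rfl | hj
  · simpa using ⟨hy j, hi⟩
  · simpa [hj] using hy j

/-! ### Generation with boundedly many new arguments -/

section Generation

variable {n : ℕ}

/-- The set generated from `Q` by the applications of `g` that have at most `m` arguments
outside `Q`. -/
inductive PartialGen (g : (Fin n → ℝ) → ℝ) (Q : Set ℝ) (m : ℕ) : ℝ → Prop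
  | base {x : ℝ} (hx : x ∈ Q) : PartialGen g Q m x
  | app (x : Fin n → ℝ) (hx : ∀ i, PartialGen g Q m (x i)) (hlt : ∀ i, x i < g x)
      (u : Finset (Fin n)) (hu : u.card ≤ m) (hQ : ∀ i ∉ u, x i ∈ Q) : PartialGen g Q m (g x)

/-- The set of all `x` with `PartialGen g Q m x`. -/
def partialGenSet (g : (Fin n → ℝ) → ℝ) (Q : Set ℝ) (m : ℕ) : Set ℝ :=
  {x | PartialGen g Q m x}

/-- The function `g` with the arguments in `u` equal to `t` and the others given by `p`. -/
def diag (g : (Fin n → ℝ) → ℝ) (u : Finset (Fin n)) (p : Fin n → ℝ) (t : ℝ) : ℝ :=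
  g fun i => if i ∈ u then t else p i

variable {g : (Fin n → ℝ) → ℝ} {Q : Set ℝ} {m : ℕ}

theorem diag_le_diag (hg : Monotone g) {u : Finset (Fin n)} {p q : Fin n → ℝ} {s t : ℝ}
    (hp : ∀ i ∉ u, p i ≤ q i) (hst : s ≤ t) : diag g u p s ≤ diag g u q t := by
  refine hg fun i => ?_
  by_cases hi : i ∈ u
  · simpa [hi] using hst
  · simpa [hi] using hp i hi

theorem le_diag (hg : Monotone g) {u : Finset (Fin n)} {x p : Fin n → ℝ} {t : ℝ}
    (hu : ∀ i ∈ u, x i ≤ t) (hp : ∀ i ∉ u, x i ≤ p i) : g x ≤ diag g u p t := by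
  refine hg fun i => ?_
  by_cases hi : i ∈ u
  · simpa [hi] using hu i hi
  · simpa [hi] using hp i hi

theorem diag_le (hg : Monotone g) {u : Finset (Fin n)} {x p : Fin n → ℝ} {t : ℝ}
    (hu : ∀ i ∈ u, t ≤ x i) (hp : ∀ i ∉ u, p i ≤ x i) : diag g u p t ≤ g x := by
  refine hg fun i => ?_
  by_cases hi : i ∈ u
  · simpa [hi] using hu i hi
  · simpa [hi] using hp i hi

theorem iterate_diag_le (hg : Monotone g) {u : Finset (Fin n)} {p q : Fin n → ℝ} {s t : ℝ}
    (hp : ∀ i ∉ u, p i ≤ q i) (hst : s ≤ t) (k : ℕ) :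
    (diag g u p)^[k] s ≤ (diag g u q)^[k] t := by
  induction k with
  | zero => exact hst
  | succ k ih =>
    rw [Function.iterate_succ_apply', Function.iterate_succ_apply']
    exact diag_le_diag hg hp ih

theorem monotone_iterate_diag (hg : Monotone g) {u : Finset (Fin n)} {p : Fin n → ℝ} {x : ℝ}
    (hx : x ≤ diag g u p x) : Monotone fun k => (diag g u p)^[k] x :=
  Monotone.monotone_iterate_of_le_map
    (fun _ _ h => diag_le_diag hg (fun _ _ => le_rfl) h) hx

theorem isPWO_pi {ι : Type} [Finite ι] {α : Type} [Preorder α] {S : ι → Set α}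
    (h : ∀ i, (S i).IsPWO) : {x : ι → α | ∀ i, x i ∈ S i}.IsPWO := by
  refine (Set.IsPWO.pi h).mono fun x hx => ?_
  simpa [Set.mem_pi] using hx

/-- A set generated from a well-ordered set by a monotone function is well-ordered. -/
theorem isWF_partialGenSet (hg : Monotone g) (hQ : Q.IsWF) : (partialGenSet g Q m).IsWF := by
  set H := partialGenSet g Q m with hH
  -- W is the well-founded part of H. A bad element whose arguments all lie in W, or which is a
  -- constant, belongs to the well-ordered set D; every bad element has such a bad one at or below
  -- it.
  let W : Set ℝ := {x | (H ∩ Set.Iio x).IsWF ∧ x ∈ H}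
  have hW : W.IsWF := by
    rw [Set.isWF_iff_no_descending_seq]
    intro f hf hfW
    refine Set.isWF_iff_no_descending_seq.1 (hfW 0).1 (fun k => f (k + 1))
      (fun a b h => hf (Nat.succ_lt_succ h)) fun k => ⟨(hfW (k + 1)).2, hf (Nat.succ_pos k)⟩
  set D : Set ℝ := Q ∪ g '' {x | ∀ i, x i ∈ W} with hD
  have hDwf : D.IsWF :=
    hQ.union ((isPWO_pi fun _ => hW.isPWO).image_of_monotone hg).isWF
  have key : ∀ a, PartialGen g Q m a → ¬ (H ∩ Set.Iio a).IsWF →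
      ∃ z ∈ H, z ∈ D ∧ z ≤ a ∧ ¬ (H ∩ Set.Iio z).IsWF := by
    intro a ha
    induction ha with
    | base hx => exact fun h => ⟨_, PartialGen.base hx, Or.inl hx, le_rfl, h⟩
    | app x hx hlt u hu hq ih =>
      intro h
      by_cases hxW : ∀ i, x i ∈ W
      · exact ⟨_, PartialGen.app x hx hlt u hu hq, Or.inr ⟨x, hxW, rfl⟩, le_rfl, h⟩
      · push Not at hxW
        obtain ⟨i, hi⟩ := hxW
        obtain ⟨z, hz, hzD, hzx, hzw⟩ := ih i fun hwf => hi ⟨hwf, hx i⟩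
        exact ⟨z, hz, hzD, hzx.trans (hlt i).le, hzw⟩
  have hall : ∀ a ∈ D, a ∈ H → (H ∩ Set.Iio a).IsWF := by
    intro a haD
    refine Set.WellFoundedOn.induction (P := fun a => a ∈ H → (H ∩ Set.Iio a).IsWF) hDwf haD ?_
    intro a haD ih haH
    by_contra hcon
    obtain ⟨f, hf⟩ : ∃ f : ℕ → ℝ, StrictAnti f ∧ ∀ k, f k ∈ H ∩ Set.Iio a := by
      rw [Set.isWF_iff_no_descending_seq] at hcon
      push Not at hcon
      exact hcon
    have h0 : ¬ (H ∩ Set.Iio (f 0)).IsWF := by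
      rw [Set.isWF_iff_no_descending_seq]
      push Not
      exact ⟨fun k => f (k + 1), fun a b h => hf.1 (Nat.succ_lt_succ h),
        fun k => ⟨(hf.2 (k + 1)).1, hf.1 (Nat.succ_pos k)⟩⟩
    obtain ⟨z, hz, hzD, hzx, hzw⟩ := key _ (hf.2 0).1 h0
    exact hzw (ih z hzD (hzx.trans_lt (hf.2 0).2) hz)
  have hHW : H ⊆ W := by
    intro a ha
    refine ⟨?_, ha⟩
    by_contra hcon
    obtain ⟨z, hz, hzD, -, hzw⟩ := key a ha hcon
    exact hzw (hall z hzD hz)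
  exact hW.mono hHW

/-- If all iterations of the diagonal functions of arity `m + 1` from points above `y₀` pass `c`,
then above some threshold `y ≥ y₀` the values less than `c` are generated with an argument at most
`y` among any `m + 1` arguments containing all those outside `Q`. -/
theorem exists_threshold (hg : Monotone g) (hQ : Q.IsWF) {H : Set ℝ} {y₀ c : ℝ} (hy₀ : y₀ ∈ H)
    (hy₀c : y₀ < c)
    (hpass : ∀ u : Finset (Fin n), u.card = m + 1 → ∀ p : Fin n → ℝ, (∀ i ∉ u, p i ∈ Q) →
      ∀ x ∈ H, y₀ < x → x < diag g u p x → ∃ k, c ≤ (diag g u p)^[k] x) :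
    ∃ y ∈ H, y₀ ≤ y ∧ y < c ∧ ∀ x : Fin n → ℝ, (∀ i, x i ∈ H) → (∀ i, x i < g x) →
      g x ∈ H → y < g x → g x < c → ∀ u : Finset (Fin n), u.card = m + 1 → (∀ i ∉ u, x i ∈ Q) →
        ∃ j ∈ u, x j ≤ y := by
  by_contra hcon
  push Not at hcon
  have hcon' : ∀ y : {y // y ∈ H ∧ y₀ ≤ y ∧ y < c}, ∃ (x : Fin n → ℝ) (u : Finset (Fin n)),
      (∀ i, x i ∈ H) ∧ (∀ i, x i < g x) ∧ g x ∈ H ∧ y.1 < g x ∧ g x < c ∧ u.card = m + 1 ∧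
        (∀ i ∉ u, x i ∈ Q) ∧ ∀ j ∈ u, y.1 < x j := by
    rintro ⟨y, hy, hyy, hyc⟩
    obtain ⟨x, h1, h2, h3, h4, h5, u, h6, h7, h8⟩ := hcon y hy hyy hyc
    exact ⟨x, u, h1, h2, h3, h4, h5, h6, h7, h8⟩
  choose X U hXH hlt hgH hyg hgc hcard hXQ hyX using hcon'
  -- Each failed threshold yields a value that serves as the next threshold. A subsequence then
  -- fixes the index set u and makes the parameters outside u increase.
  let Y : ℕ → {y // y ∈ H ∧ y₀ ≤ y ∧ y < c} := fun k =>
    Nat.rec ⟨y₀, hy₀, le_rfl, hy₀c⟩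
      (fun _ y => ⟨g (X y), hgH y, y.2.2.1.trans (hyg y).le, hgc y⟩) k
  have hYs : ∀ k, (Y (k + 1)).1 = g (X (Y k)) := fun k => rfl
  have hYmono : StrictMono fun k => (Y k).1 := strictMono_nat_of_lt_succ fun k => hyg (Y k)
  classical
  obtain ⟨u, hu⟩ := Finite.exists_infinite_fiber fun k => U (Y k)
  let φ : ℕ ↪o ℕ := Nat.orderEmbeddingOfSet ((fun k => U (Y k)) ⁻¹' {u})
  have hφ : ∀ k, U (Y (φ k)) = u := fun k =>
    (Nat.orderEmbeddingOfSet_range ((fun k => U (Y k)) ⁻¹' {u})).subset ⟨k, rfl⟩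
  have hpwo : {v : Fin n → ℝ | ∀ i, v i ∈ insert 0 Q}.IsPWO :=
    isPWO_pi fun _ => (hQ.insert 0).isPWO
  obtain ⟨ψ, hψ⟩ := hpwo.exists_monotone_subseq
    (f := fun k i => if i ∈ u then 0 else X (Y (φ k)) i) (fun k i => by
      by_cases hi : i ∈ u
      · simp [hi]
      · simpa [hi] using Or.inr (hXQ (Y (φ k)) i (by rwa [hφ k])))
  let Z : ℕ → {y // y ∈ H ∧ y₀ ≤ y ∧ y < c} := fun k => Y (φ (ψ k))
  have hZU : ∀ k, U (Z k) = u := fun k => hφ _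
  have hZmono : ∀ k, g (X (Z k)) ≤ (Z (k + 1)).1 := fun k => by
    have : φ (ψ k) + 1 ≤ φ (ψ (k + 1)) := φ.strictMono (ψ.strictMono (Nat.lt_succ_self k))
    exact hYmono.monotone this
  have hXmono : ∀ k, ∀ i ∉ u, X (Z 0) i ≤ X (Z k) i := fun k i hi => by
    have := hψ (Nat.zero_le k) i
    simpa [hi] using this
  have hcu : u.card = m + 1 := by rw [← hZU 0]; exact hcard _
  obtain ⟨j, hj⟩ : u.Nonempty := Finset.card_pos.1 (by omega)
  have : Nonempty (Fin n) := ⟨j⟩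
  obtain ⟨j', hj'⟩ := Finite.exists_max (X (Z 0))
  obtain ⟨k, hk⟩ := hpass u hcu (X (Z 0)) (fun i hi => hXQ _ i (by rwa [hZU])) (X (Z 0) j')
    (hXH _ j')
    ((((Z 0).2.2.1.trans_lt (hyX (Z 0) j (by rwa [hZU]))).trans_le (hj' j)))
    ((hlt (Z 0) j').trans_le (le_diag hg (fun i _ => hj' i) fun _ _ => le_rfl))
  -- The iterates of one fixed diagonal function stay below these values, hence below c,
  -- contradicting `hpass`.
  have hiter : ∀ k, (diag g u (X (Z 0)))^[k] (X (Z 0) j') ≤ g (X (Z k)) := by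
    intro k
    induction k with
    | zero => exact (hlt (Z 0) j').le
    | succ k ih =>
      rw [Function.iterate_succ_apply']
      refine (diag_le_diag hg (fun _ _ => le_rfl) (ih.trans (hZmono k))).trans ?_
      exact diag_le hg (fun i hi => (hyX (Z (k + 1)) i (by rwa [hZU])).le) (hXmono (k + 1))
  exact absurd (hk.trans (hiter k)) (not_le.2 (hgc _))

end Generation

/-! ### Bounds on ordinals -/

theorem add_lt_veblen {a b c d : Ordinal.{0}} (ha : a < veblen c d) (hb : b < veblen c d) :
    a + b < veblen c d := by
  obtain ⟨e, he⟩ := veblen_mem_range_opow c d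
  simp only at he
  rw [← he] at ha hb ⊢
  exact isPrincipal_add_omega0_opow e ha hb

/-- Values of `veblen b` are fixed points of `veblen a` for a < b. -/
theorem iterate_veblen_lt {a b c d : Ordinal.{0}} (hab : a < b) (hc : c < veblen b d) (k : ℕ) :
    (veblen a)^[k] c < veblen b d := by
  induction k with
  | zero => exact hc
  | succ k ih =>
    rw [Function.iterate_succ_apply', ← veblen_veblen_of_lt hab d]
    exact veblen_right_strictMono a ih

theorem iterate_veblen_le_succ (a c : Ordinal.{0}) (k : ℕ) :
    (veblen a)^[k] c ≤ (veblen a)^[k + 1] c := by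
  rw [Function.iterate_succ_apply']
  exact right_le_veblen _ _

theorem le_iterate_veblen (a c : Ordinal.{0}) (k : ℕ) : c ≤ (veblen a)^[k] c := by
  induction k with
  | zero => exact le_rfl
  | succ k ih => exact ih.trans (iterate_veblen_le_succ a c k)

theorem iterate_veblen_le_left {a b : Ordinal.{0}} (hab : a ≤ b) (c : Ordinal.{0}) (k : ℕ) :
    (veblen a)^[k] c ≤ (veblen b)^[k] c := by
  induction k with
  | zero => exact le_rfl
  | succ k ih =>
    rw [Function.iterate_succ_apply', Function.iterate_succ_apply']
    exact (veblen_left_monotone _ hab).trans ((veblen_right_strictMono b).monotone ih)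

theorem add_add_one_lt_iterate_veblen {a θ ξ : Ordinal.{0}} {k : ℕ}
    (hξ : ξ < (veblen 0)^[k] (θ + 1)) : θ + (ξ + 1) < (veblen a)^[k + 1] (θ + 1) := by
  have h1 : θ + 1 ≤ (veblen a)^[k] (θ + 1) := le_iterate_veblen _ _ _
  rw [Function.iterate_succ_apply']
  refine add_lt_veblen ?_ (add_lt_veblen ?_ ?_)
  · exact ((lt_add_one θ).trans_le h1).trans_le (right_le_veblen _ _)
  · exact (hξ.trans_le (iterate_veblen_le_left zero_le _ _)).trans_le (right_le_veblen _ _)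
  · have h0 : (1 : Ordinal.{0}) ≤ veblen a 0 := Order.one_le_iff_pos.2 veblen_pos
    refine h0.trans_lt (veblen_right_strictMono a ?_)
    exact lt_of_lt_of_le (by simp) h1

/-! ### Order types between consecutive limit points -/

section OrderType

variable {α : Type} [LinearOrder α] {s t : Set α}

theorem OrderTypeLT.union_veblen {a b : Ordinal.{0}} (hs : OrderTypeLT s (veblen a b))
    (ht : OrderTypeLT t (veblen a b)) : OrderTypeLT (s ∪ t) (veblen a b) := by
  obtain ⟨e, he⟩ := veblen_mem_range_opow a b
  simp only at he
  rw [← he] at hs ht ⊢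
  exact hs.union ht

theorem OrderTypeLT.Iic {y : α} {a b : Ordinal.{0}} (hab : a < b)
    (h : OrderTypeLT (s ∩ Set.Iio y) (ω ^ b)) : OrderTypeLT (s ∩ Set.Iic y) (ω ^ b) := by
  obtain ⟨o, ho, hs⟩ := h
  refine ⟨o + 1, isPrincipal_add_omega0_opow b ho ?_, hs.Iic⟩
  rw [← opow_zero ω]
  exact (Ordinal.opow_lt_opow_iff_right one_lt_omega0).2 (zero_le.trans_lt hab)

/-- A set `H` whose initial segments do not reach the next value of `Φ` between consecutive points
of a set `B` of order type at most `ξ` has order type at most `Φ (ξ + 1)`. -/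
theorem orderTypeLE_of_step {β : Type} [LinearOrder β] {H : Set α} {B : Set β} (e : α → β)
    (hH : H.IsWF) (he : Monotone e) {ξ : Ordinal.{0}} (hB : OrderTypeLE B ξ)
    {Φ : Ordinal.{0} → Ordinal.{0}} (hΦ : StrictMono Φ)
    (step : ∀ ν, ∀ c ∈ H, ∀ y₀ ∈ H, y₀ < c → (∀ b ∈ B, e y₀ < b → e c < b) →
      (∀ y ∈ H, y < c → OrderTypeLT (H ∩ Set.Iio y) (Φ (ν + 1))) →
      OrderTypeLT (H ∩ Set.Iio c) (Φ (ν + 1))) :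
    OrderTypeLE H (Φ (ξ + 1)) := by
  let ν : α → Ordinal.{0} := fun x => sInf {o | OrderTypeLE (B ∩ Set.Iic (e x)) o}
  have hν : ∀ x, OrderTypeLE (B ∩ Set.Iic (e x)) (ν x) := fun x =>
    csInf_mem (s := {o | OrderTypeLE (B ∩ Set.Iic (e x)) o})
      ⟨ξ, hB.mono Set.inter_subset_left le_rfl⟩
  have hνle : ∀ {x o}, OrderTypeLE (B ∩ Set.Iic (e x)) o → ν x ≤ o := fun {x o} h =>
    csInf_le' (s := {o | OrderTypeLE (B ∩ Set.Iic (e x)) o}) h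
  have hνmono : ∀ x y, x ≤ y → ν x ≤ ν y := fun x y h =>
    hνle ((hν y).mono (fun b hb => ⟨hb.1, hb.2.trans (he h)⟩) le_rfl)
  have hΦν : ∀ x y, ν x ≤ ν y → Φ (ν x + 1) ≤ Φ (ν y + 1) := fun x y h =>
    hΦ.monotone (add_le_add_left h 1)
  have key : ∀ c ∈ H, OrderTypeLT (H ∩ Set.Iio c) (Φ (ν c + 1)) := by
    intro c hc
    refine Set.WellFoundedOn.induction hH
      (P := fun c => OrderTypeLT (H ∩ Set.Iio c) (Φ (ν c + 1))) hc ?_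
    intro c hc ih
    by_cases hcase : ∃ y₀ ∈ H, y₀ < c ∧ ∀ b ∈ B, e y₀ < b → e c < b
    · obtain ⟨y₀, hy₀, hy₀c, hb⟩ := hcase
      exact step (ν c) c hc y₀ hy₀ hy₀c hb fun y hy hyc =>
        (ih y hy hyc).mono le_rfl (hΦν _ _ (hνmono y c hyc.le))
    -- Every y in H below c is now separated from c by a point of B, so ν y < ν c and the segment
    -- below y stays under Φ (ν c). No continuity of Φ is needed.
    · push Not at hcase
      refine ⟨Φ (ν c), hΦ (lt_add_one _), orderTypeLE_iff.2 fun y hy => ?_⟩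
      obtain ⟨b, hbB, hyb, hbc⟩ := hcase y hy.1 hy.2
      refine (ih y hy.1 hy.2).mono (fun z hz => ⟨hz.1.1, hz.2⟩) (hΦ.monotone ?_)
      refine Order.add_one_le_of_lt ?_
      obtain ⟨o, ho, hBo⟩ := orderTypeLE_iff.1 (hν c) b ⟨hbB, hbc⟩
      refine (hνle (hBo.mono (fun b' hb' => ?_) le_rfl)).trans_lt ho
      exact ⟨⟨hb'.1, (lt_of_le_of_lt hb'.2 hyb).le.trans hbc⟩, lt_of_le_of_lt hb'.2 hyb⟩
  refine orderTypeLE_iff.2 fun c hc => (key c hc).mono le_rfl (hΦ.monotone ?_)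
  exact add_le_add_left (hνle (hB.mono Set.inter_subset_left le_rfl)) 1

end OrderType

/-! ### Limits of diagonal functions -/

section Limits

variable {n : ℕ} {g : (Fin n → ℝ) → ℝ} {Q : Set ℝ} {m : ℕ}

/-- The limit of the iterates of a diagonal function at a point of increase. -/
noncomputable def diagLimit (g : (Fin n → ℝ) → ℝ) (u : Finset (Fin n)) (p : Fin n → ℝ) (x : ℝ) :
    EReal :=
  ⨆ k : ℕ, (((diag g u p)^[k] x : ℝ) : EReal)

/-- The limits of iterates of diagonal functions with parameters in `Q` and starting points
in `H`. -/
def diagLimits (g : (Fin n → ℝ) → ℝ) (u : Finset (Fin n)) (Q H : Set ℝ) : Set EReal :=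
  {b | ∃ p : Fin n → ℝ, (∀ i ∉ u, p i ∈ Q) ∧ ∃ x ∈ H, x < diag g u p x ∧ diagLimit g u p x = b}

/-- Tameness only speaks of well-ordered sets of limits. Restricting the starting points to H
secures this, since the limit is monotone in parameters and starting point jointly. -/
theorem isWF_diagLimits (hg : Monotone g) (u : Finset (Fin n)) {H : Set ℝ} (hQ : Q.IsWF)
    (hH : H.IsWF) : (diagLimits g u Q H).IsWF := by
  have hpwo : {v : Fin n → ℝ | ∀ i, v i ∈ insert 0 Q}.IsPWO :=
    isPWO_pi fun _ => (hQ.insert 0).isPWO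
  have hmono : Monotone fun q : (Fin n → ℝ) × ℝ => diagLimit g u q.1 q.2 := fun q r h =>
    iSup_mono fun k => EReal.coe_le_coe_iff.2 (iterate_diag_le hg (fun i _ => h.1 i) h.2 k)
  refine ((hpwo.prod hH.isPWO).image_of_monotone hmono).isWF.mono ?_
  rintro b ⟨p, hp, x, hx, -, rfl⟩
  refine ⟨(fun i => if i ∈ u then 0 else p i, x), ⟨fun i => ?_, hx⟩, ?_⟩
  · by_cases hi : i ∈ u
    · simp [hi]
    · simpa [hi] using Or.inr (hp i hi)
  · have : diag g u (fun i => if i ∈ u then 0 else p i) = diag g u p := by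
      funext t
      refine congrArg g (funext fun i => ?_)
      by_cases hi : i ∈ u <;> simp [hi]
    simp only [diagLimit, this]

theorem diagLimits_subset (hg : Monotone g) (u : Finset (Fin n)) (Q H : Set ℝ) :
    diagLimits g u Q H ⊆ familyLimitPoints (diagRestrict g u) Q := by
  rintro b ⟨p, hp, x, hx, hlt, rfl⟩
  have hdiag : diagRestrict g u (fun i => p i) = diag g u p := by
    funext t
    refine congrArg g (funext fun i => ?_)
    by_cases hi : i ∈ u <;> simp [hi]
  refine ⟨fun i => p i, fun i => hp i i.2, x, ?_, ?_⟩
  · rwa [hdiag]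
  · rw [hdiag]
    exact tendsto_atTop_iSup fun k l hkl =>
      EReal.coe_le_coe_iff.2 (monotone_iterate_diag hg hlt.le hkl)

theorem IsTame.exists_bound_diagLimits (hg : Monotone g) (ht : IsTame g) (hm : m < n) :
    ∃ k : ℕ, ∀ (Q H : Set ℝ) (θ : Ordinal.{0}), OrderTypeLE Q θ → H.IsWF →
      OrderTypeLT (⋃ u : {u : Finset (Fin n) // u.card = m}, diagLimits g u Q H)
        ((veblen 0)^[k] (θ + 1)) := by
  obtain ⟨k, hk⟩ := ht
  -- The extra φ_0 makes the bound a power of ω, which absorbs the finite union over u.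
  refine ⟨k + 1, fun Q H θ hQ hH => ?_⟩
  rw [Function.iterate_succ_apply', veblen_zero_apply]
  refine OrderTypeLT.iUnion fun u => ?_
  have hwf := isWF_diagLimits hg u hQ.isWF hH
  have := hQ.wellFoundedLT
  have : WellFoundedLT (diagLimits g u.1 Q H) := ⟨hwf⟩
  have hu : u.1 ⊂ Finset.univ := by
    rw [Finset.ssubset_univ_iff]
    intro h
    have := u.2
    rw [h, Finset.card_univ, Fintype.card_fin] at this
    omega
  refine ⟨_, (hk u hu Q _ (diagLimits_subset hg u Q H)).trans_le ?_, orderTypeLE_ot⟩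
  refine le_trans ?_ (right_le_opow _ one_lt_omega0)
  exact (veblen_right_strictMono 0).monotone.iterate k (add_le_add_left hQ.ot_le 1)

/-- A form of `exists_threshold` for intervals free of limits of diagonal functions. -/
theorem exists_threshold_of_diagLimits (hg : Monotone g) (hQ : Q.IsWF) {H : Set ℝ} {y₀ c : ℝ}
    (hy₀ : y₀ ∈ H) (hy₀c : y₀ < c)
    (hb : ∀ b ∈ ⋃ u : {u : Finset (Fin n) // u.card = m + 1}, diagLimits g u Q H,
      (y₀ : EReal) < b → (c : EReal) < b) :
    ∃ y ∈ H, y₀ ≤ y ∧ y < c ∧ ∀ x : Fin n → ℝ, (∀ i, x i ∈ H) → (∀ i, x i < g x) →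
      g x ∈ H → y < g x → g x < c → ∀ u : Finset (Fin n), u.card = m + 1 → (∀ i ∉ u, x i ∈ Q) →
        ∃ j ∈ u, x j ≤ y := by
  refine exists_threshold hg hQ hy₀ hy₀c fun u hu p hp x hx hyx hlt => ?_
  have h1 : (c : EReal) < diagLimit g u p x := by
    refine hb _ (Set.mem_iUnion.2 ⟨⟨u, hu⟩, p, hp, x, hx, hlt, rfl⟩) ?_
    exact (EReal.coe_lt_coe_iff.2 hyx).trans_le
      (le_iSup (fun k : ℕ => (((diag g u p)^[k] x : ℝ) : EReal)) 0)
  obtain ⟨k, hk⟩ := lt_iSup_iff.1 h1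
  exact ⟨k, (EReal.coe_lt_coe_iff.1 hk).le⟩

/-- Beyond a threshold, one argument less is needed. -/
theorem partialGenSet_inter_Iio_subset {y c : ℝ}
    (h : ∀ x : Fin n → ℝ, (∀ i, x i ∈ partialGenSet g Q (m + 1)) → (∀ i, x i < g x) →
      g x ∈ partialGenSet g Q (m + 1) → y < g x → g x < c →
      ∀ u : Finset (Fin n), u.card = m + 1 → (∀ i ∉ u, x i ∈ Q) → ∃ j ∈ u, x j ≤ y) :
    partialGenSet g Q (m + 1) ∩ Set.Iio c ⊆
      partialGenSet g (Q ∪ (partialGenSet g Q (m + 1) ∩ Set.Iic y)) m := by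
  rintro z ⟨hz, hzc⟩
  rw [Set.mem_Iio] at hzc
  induction hz with
  | base hx => exact PartialGen.base (Or.inl hx)
  | app x hx hlt u hu hQ ih =>
    have hgx : g x ∈ partialGenSet g Q (m + 1) := PartialGen.app x hx hlt u hu hQ
    rcases le_or_gt (g x) y with hy | hy
    · exact PartialGen.base (Or.inr ⟨hgx, hy⟩)
    have ih' := fun i => ih i ((hlt i).trans hzc)
    rcases Nat.lt_or_ge m u.card with hum | hum
    -- The argument x j has become a constant, so j can be dropped from u.
    · obtain ⟨j, hj, hjy⟩ := h x hx hlt hgx hy hzc u (by omega) hQ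
      refine PartialGen.app x ih' hlt (u.erase j) (by rw [Finset.card_erase_of_mem hj]; omega) ?_
      intro i hi
      rcases eq_or_ne i j with rfl | hij
      · exact Or.inr ⟨hx i, hjy⟩
      · exact Or.inl (hQ i fun hiu => hi (Finset.mem_erase.2 ⟨hij, hiu⟩))
    · exact PartialGen.app x ih' hlt u hum fun i hi => Or.inl (hQ i hi)

/-- Beyond a threshold, the values of unary restrictions are values at arguments below the
threshold. -/
theorem partialGenSet_one_inter_Iio_subset [NeZero n] {y c : ℝ}
    (h : ∀ x : Fin n → ℝ, (∀ i, x i ∈ partialGenSet g Q 1) → (∀ i, x i < g x) →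
      g x ∈ partialGenSet g Q 1 → y < g x → g x < c →
      ∀ u : Finset (Fin n), u.card = 1 → (∀ i ∉ u, x i ∈ Q) → ∃ j ∈ u, x j ≤ y) :
    partialGenSet g Q 1 ∩ Set.Iio c ⊆ (Q ∪ (partialGenSet g Q 1 ∩ Set.Iic y)) ∪
      ⋃ i, g '' {x | ∀ j, x j ∈
        Function.update (fun _ => Q) i (Q ∪ (partialGenSet g Q 1 ∩ Set.Iic y)) j} := by
  rintro z ⟨hz, hzc⟩
  rw [Set.mem_Iio] at hzc
  cases hz with
  | base hx => exact Or.inl (Or.inl hx)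
  | app x hx hlt u hu hQ =>
    have hgx : g x ∈ partialGenSet g Q 1 := PartialGen.app x hx hlt u hu hQ
    rcases le_or_gt (g x) y with hy | hy
    · exact Or.inl (Or.inr ⟨hgx, hy⟩)
    refine Or.inr (Set.mem_iUnion.2 ?_)
    rcases Nat.lt_or_ge 0 u.card with hum | hum
    · have hu1 : u.card = 1 := by omega
      obtain ⟨i, rfl⟩ := Finset.card_eq_one.1 hu1
      obtain ⟨j, hj, hjy⟩ := h x hx hlt hgx hy hzc {i} hu1 hQ
      rw [Finset.mem_singleton] at hj
      subst hj
      refine ⟨j, x, fun i => ?_, rfl⟩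
      rcases eq_or_ne i j with rfl | hij
      · rw [Function.update_self]
        exact Or.inr ⟨hx i, hjy⟩
      · rw [Function.update_of_ne hij]
        exact hQ i (by simpa using hij)
    · have hu0 : u = ∅ := Finset.card_eq_zero.1 (by omega)
      subst hu0
      refine ⟨0, x, fun i => ?_, rfl⟩
      rcases eq_or_ne i 0 with rfl | hij
      · rw [Function.update_self]
        exact Or.inl (hQ 0 (by simp))
      · rw [Function.update_of_ne hij]
        exact hQ i (by simp)

theorem exists_bound_partialGenSet_one (hg : Monotone g) (ht : IsTame g) (hn : 1 < n) :
    ∃ k : ℕ, ∀ (Q : Set ℝ) (θ : Ordinal.{0}), OrderTypeLE Q θ →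
      OrderTypeLT (partialGenSet g Q 1) ((veblen 0)^[k] (θ + 1)) := by
  have : NeZero n := ⟨by omega⟩
  obtain ⟨k, hk⟩ := ht.exists_bound_diagLimits hg hn
  refine ⟨k + 3, fun Q θ hQ => ?_⟩
  have hH := isWF_partialGenSet (m := 1) hg hQ.isWF
  obtain ⟨ξ, hξ, hB⟩ := hk Q _ θ hQ hH
  -- Double exponentials absorb one evaluation of g: an exponent below ω ^ δ plus finitely many
  -- copies of θ, in the natural sum, stays below ω ^ δ. The summand θ makes room for Q.
  refine ⟨ω ^ ω ^ (θ + (ξ + 1)), ?_, ?_⟩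
  · rw [Function.iterate_succ_apply', Function.iterate_succ_apply', veblen_zero_apply,
      veblen_zero_apply]
    refine (Ordinal.opow_lt_opow_iff_right one_lt_omega0).2
      ((Ordinal.opow_lt_opow_iff_right one_lt_omega0).2 ?_)
    exact add_add_one_lt_iterate_veblen hξ
  refine orderTypeLE_of_step (fun x : ℝ => (x : EReal)) hH EReal.coe_strictMono.monotone hB
    (Φ := fun ν => ω ^ ω ^ (θ + ν)) (fun a b h => ?_) ?_
  · refine (Ordinal.opow_lt_opow_iff_right one_lt_omega0).2
      ((Ordinal.opow_lt_opow_iff_right one_lt_omega0).2 ?_)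
    exact (add_lt_add_iff_left _).2 h
  intro ν c hc y₀ hy₀ hy₀c hb ih
  obtain ⟨y, hy, -, hyc, hthr⟩ := exists_threshold_of_diagLimits (m := 0) hg hQ.isWF hy₀ hy₀c hb
  set δ := θ + (ν + 1) with hδ
  have hθδ : θ < ω ^ δ := by
    refine lt_of_lt_of_le ?_ (right_le_opow δ one_lt_omega0)
    rw [hδ, ← add_assoc]
    exact Order.lt_add_one_iff.2 (le_add_right le_rfl)
  have hQδ : OrderTypeLT Q (ω ^ ω ^ δ) :=
    ⟨θ, hθδ.trans_le (right_le_opow _ one_lt_omega0), hQ⟩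
  have hX : OrderTypeLT (Q ∪ (partialGenSet g Q 1 ∩ Set.Iic y)) (ω ^ ω ^ δ) :=
    hQδ.union ((ih y hy hyc).Iic (opow_pos δ omega0_pos))
  refine (hX.union (OrderTypeLT.iUnion fun i => ?_)).mono
    (partialGenSet_one_inter_Iio_subset hthr) le_rfl
  obtain ⟨o, ho, hXo⟩ := hX
  obtain ⟨ε, hε, N, hN⟩ := (lt_omega0_opow (opow_ne_zero _ omega0_ne_zero)).1 ho
  have hε' : ε + 1 < ω ^ δ := by
    refine isPrincipal_add_omega0_opow δ hε ?_
    rw [← opow_zero ω]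
    refine (Ordinal.opow_lt_opow_iff_right one_lt_omega0).2 ?_
    rw [hδ, ← add_assoc]
    exact lt_of_le_of_lt zero_le (lt_add_one _)
  have hXε : OrderTypeLE (Q ∪ (partialGenSet g Q 1 ∩ Set.Iic y)) (ω ^ (ε + 1)) := by
    refine hXo.mono le_rfl (hN.trans ?_).le
    exact opow_mul_lt_opow (natCast_lt_omega0 N) (lt_add_one ε)
  refine ⟨_, ?_, OrderTypeLE.image_pi hg (a := Function.update (fun _ => θ) i (ε + 1)) fun j => ?_⟩
  · refine (Ordinal.opow_lt_opow_iff_right one_lt_omega0).2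
      (naturalSum_lt_omega0_opow fun j => ?_)
    rcases eq_or_ne j i with rfl | hj
    · simpa using hε'
    · simpa [hj] using hθδ
  · rcases eq_or_ne j i with rfl | hj
    · simpa using hXε
    · simpa [hj] using hQ.mono le_rfl (right_le_opow θ one_lt_omega0)

theorem exists_bound_partialGenSet (hg : Monotone g) (ht : IsTame g) (hm : m + 1 < n) :
    ∃ k : ℕ, ∀ (Q : Set ℝ) (θ : Ordinal.{0}), OrderTypeLE Q θ →
      OrderTypeLT (partialGenSet g Q (m + 1)) ((veblen m)^[k] (θ + 1)) := by
  induction m with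
  | zero => simpa using exists_bound_partialGenSet_one hg ht hm
  | succ m ih =>
    obtain ⟨l, hl⟩ := ih (by omega)
    obtain ⟨k, hk⟩ := ht.exists_bound_diagLimits hg hm
    refine ⟨k + 2, fun Q θ hQ => ?_⟩
    have hH := isWF_partialGenSet (m := m + 1 + 1) hg hQ.isWF
    obtain ⟨ξ, hξ, hB⟩ := hk Q _ θ hQ hH
    refine ⟨veblen (m + 1 : ℕ) (θ + (ξ + 1)), ?_, ?_⟩
    · rw [Function.iterate_succ_apply']
      exact veblen_right_strictMono _ (add_add_one_lt_iterate_veblen hξ)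
    refine orderTypeLE_of_step (fun x : ℝ => (x : EReal)) hH EReal.coe_strictMono.monotone hB
      (Φ := fun ν => veblen (m + 1 : ℕ) (θ + ν))
      (fun a b h => veblen_right_strictMono _ ((add_lt_add_iff_left _).2 h)) ?_
    intro ν c hc y₀ hy₀ hy₀c hb ih
    obtain ⟨y, hy, -, hyc, hthr⟩ := exists_threshold_of_diagLimits hg hQ.isWF hy₀ hy₀c hb
    rw [← add_assoc] at ih ⊢
    have h1 : (1 : Ordinal.{0}) < veblen (m + 1 : ℕ) (θ + ν + 1) := by
      refine lt_of_le_of_lt (Order.one_le_iff_pos.2 (veblen_pos (o := (m + 1 : ℕ)) (a := 0)))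
        (veblen_right_strictMono _ (lt_of_le_of_lt zero_le (lt_add_one _)))
    obtain ⟨o, ho, hyo⟩ := ih y hy hyc
    have hX : OrderTypeLT (Q ∪ (partialGenSet g Q (m + 1 + 1) ∩ Set.Iic y))
        (veblen (m + 1 : ℕ) (θ + ν + 1)) := by
      refine OrderTypeLT.union_veblen ⟨θ, ?_, hQ⟩ ⟨o + 1, add_lt_veblen ho h1, hyo.Iic⟩
      exact (Order.lt_add_one_iff.2 (le_add_right le_rfl)).trans_le (right_le_veblen _ _)
    obtain ⟨η, hη, hXη⟩ := hX
    refine (hl _ η hXη).mono (partialGenSet_inter_Iio_subset hthr) ?_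
    exact (iterate_veblen_lt (Nat.cast_lt.2 (Nat.lt_succ_self m)) (add_lt_veblen hη h1) l).le

end Limits

/-! ### All arguments new: the first claim -/

section Main

variable {n : ℕ} {g : (Fin n → ℝ) → ℝ}

theorem generatedSet_eq_partialGenSet (g : (Fin n → ℝ) → ℝ) (P : Set ℝ) :
    generatedSet {⟨n, g⟩} P = partialGenSet g P n := by
  ext z
  constructor
  · intro hz
    induction hz with
    | const hx => exact PartialGen.base hx
    | app hmem x hx hlt ih =>
      obtain ⟨rfl, h⟩ := Sigma.mk.inj_iff.1 (Set.mem_singleton_iff.1 hmem)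
      obtain rfl := eq_of_heq h
      exact PartialGen.app x ih hlt Finset.univ (by simp) (by simp)
  · intro hz
    induction hz with
    | base hx => exact Generated.const hx
    | app x hx hlt u hu hQ ih => exact Generated.app (Set.mem_singleton _) x ih hlt

theorem PartialGen.nonneg [NeZero n] {m : ℕ} {x : ℝ} (hx : PartialGen g {0} m x) : 0 ≤ x := by
  induction hx with
  | base hx => exact (Set.mem_singleton_iff.1 hx).ge
  | app x hx hlt u hu hQ ih => exact (ih 0).trans (hlt 0).le

/-- By induction the arguments lie below iterates; one more step of the full diagonal from a common
later iterate dominates the value. -/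
theorem PartialGen.exists_le_iterate (hg : Monotone g) {m : ℕ} {p : Fin n → ℝ} {x c : ℝ}
    (hc : PartialGen g {0} m c) (hx0 : 0 ≤ x) (hx : x ≤ diag g Finset.univ p x) :
    ∃ k, c ≤ (diag g Finset.univ p)^[k] x := by
  induction hc with
  | base hc => exact ⟨0, (Set.mem_singleton_iff.1 hc).trans_le hx0⟩
  | app y hy hlt u hu hQ ih =>
    choose k hk using ih
    refine ⟨∑ i, k i + 1, ?_⟩
    rw [Function.iterate_succ_apply']
    refine le_diag hg (fun i _ => (hk i).trans ?_) (fun i hi => absurd (Finset.mem_univ i) hi)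
    exact monotone_iterate_diag hg hx (Finset.single_le_sum (fun _ _ => Nat.zero_le _)
      (Finset.mem_univ i))

/-- The set generated from `0` by a tame monotone function of `m + 2` variables. -/
theorem orderTypeLE_generated {m : ℕ} {g : (Fin (m + 2) → ℝ) → ℝ} (hg : Monotone g)
    (ht : IsTame g) : OrderTypeLE (partialGenSet g {0} (m + 2)) (veblen (m + 1 : ℕ) 0) := by
  have hQ : ({0} : Set ℝ).IsWF := Set.isWF_singleton
  have hH := isWF_partialGenSet (m := m + 2) hg hQ
  obtain ⟨k, hk⟩ := exists_bound_partialGenSet (m := m) hg ht (by omega)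
  have h0 : (0 : Ordinal.{0}) < veblen (m + 1 : ℕ) 0 := veblen_pos
  have h1 : (1 : Ordinal.{0}) < veblen (m + 1 : ℕ) 0 := by
    rw [← veblen_veblen_of_lt (Nat.cast_lt.2 (Nat.succ_pos m)), Nat.cast_zero, veblen_zero_apply,
      ← opow_zero ω]
    exact (Ordinal.opow_lt_opow_iff_right one_lt_omega0).2 veblen_pos
  refine orderTypeLE_iff.2 fun c hc => ?_
  refine Set.WellFoundedOn.induction hH
    (P := fun c => OrderTypeLT (partialGenSet g {0} (m + 2) ∩ Set.Iio c) _) hc ?_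
  intro c hc ih
  rcases (partialGenSet g {0} (m + 2) ∩ Set.Iio c).eq_empty_or_nonempty with he | ⟨y₀, hy₀, hy₀c⟩
  · exact ⟨0, h0, he ▸ orderTypeLE_empty 0⟩
  -- Index sets of size m + 2 are full, and iterates of the full diagonal always pass c, so a
  -- threshold exists below every c that is not least.
  obtain ⟨y, hy, -, hyc, hthr⟩ := exists_threshold (m := m + 1) hg hQ hy₀ hy₀c (by
    intro u hu p _ x hx _ hlt
    obtain rfl : u = Finset.univ := Finset.eq_univ_of_card u (by simpa using hu)
    exact PartialGen.exists_le_iterate hg hc (PartialGen.nonneg hx) hlt.le)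
  obtain ⟨o, ho, hyo⟩ := ih y hy hyc
  have hX : OrderTypeLT ({0} ∪ (partialGenSet g {0} (m + 2) ∩ Set.Iic y)) (veblen (m + 1 : ℕ) 0) :=
    OrderTypeLT.union_veblen ⟨1, h1, orderTypeLE_singleton 0⟩
      ⟨o + 1, add_lt_veblen ho h1, hyo.Iic⟩
  obtain ⟨η, hη, hXη⟩ := hX
  refine (hk _ η hXη).mono (partialGenSet_inter_Iio_subset hthr) ?_
  exact (iterate_veblen_lt (Nat.cast_lt.2 (Nat.lt_succ_self m)) (add_lt_veblen hη h1) k).le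

end Main

/-! ### Tameness of linear functions -/

section Linear

/-- A finite limit is a fixed point r by continuity, and the strict increase at x < r forces slope a
< 1. -/
theorem eq_div_of_mem_limitPoints {a b r : ℝ} (hr : (r : EReal) ∈ limitPoints fun t => a * t + b)
    (ha : 0 ≤ a) : a < 1 ∧ r = b / (1 - a) := by
  obtain ⟨x, hx, hlim⟩ := hr
  have hmono : Monotone fun t : ℝ => a * t + b := fun s t h => by
    simpa using mul_le_mul_of_nonneg_left h ha
  have hlim' : Tendsto (fun i : ℕ => (fun t => a * t + b)^[i] x) atTop (𝓝 r) :=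
    EReal.tendsto_coe.1 hlim
  have hfix : a * r + b = r := isFixedPt_of_tendsto_iterate hlim'
    (by fun_prop : Continuous fun t : ℝ => a * t + b).continuousAt
  have hxr : a * x + b ≤ r :=
    (Monotone.monotone_iterate_of_le_map hmono hx.le).ge_of_tendsto hlim' 1
  have ha1 : a < 1 := by
    by_contra hcon
    nlinarith
  exact ⟨ha1, by rw [eq_div_iff (by linarith)]; linarith⟩

theorem monotone_linear {n : ℕ} {a : Fin n → ℝ} (C : ℝ) (ha : ∀ i, 0 ≤ a i) :
    Monotone fun x : Fin n → ℝ => (∑ i, a i * x i) + C := fun x y h => by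
  have : ∑ i, a i * x i ≤ ∑ i, a i * y i :=
    Finset.sum_le_sum fun i _ => mul_le_mul_of_nonneg_left (h i) (ha i)
  simpa using this

theorem isTame_linear {n : ℕ} {a : Fin n → ℝ} (C : ℝ) (ha : ∀ i, 0 ≤ a i) :
    IsTame fun x : Fin n → ℝ => (∑ i, a i * x i) + C := by
  refine ⟨2, fun u hu P _ B _ hB => ?_⟩
  set A : ℝ := ∑ i ∈ u, a i with hA
  have hA0 : 0 ≤ A := Finset.sum_nonneg fun i _ => ha i
  set b : (Fin n → ℝ) → ℝ := fun v => (∑ i ∈ uᶜ, a i * v i) + C with hb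
  have hdiag : ∀ p : {i // i ∉ u} → ℝ,
      diagRestrict (fun x : Fin n → ℝ => (∑ i, a i * x i) + C) u p =
        fun t => A * t + b fun i => if h : i ∈ u then 0 else p ⟨i, h⟩ := by
    intro p
    funext t
    simp only [diagRestrict, restrict, hb, hA, ← add_assoc]
    rw [← Finset.sum_add_sum_compl u, Finset.sum_mul]
    congr 2
    · exact Finset.sum_congr rfl fun i hi => by simp [hi]
    · exact Finset.sum_congr rfl fun i hi => by simp [Finset.mem_compl.1 hi]
  have hbmono : Monotone b := fun v w h => by
    have : ∑ i ∈ uᶜ, a i * v i ≤ ∑ i ∈ uᶜ, a i * w i :=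
      Finset.sum_le_sum fun i _ => mul_le_mul_of_nonneg_left (h i) (ha i)
    simpa [hb] using this
  -- The coordinates in u do not enter b; the dummy value 0 keeps their factors well-ordered.
  set S : Fin n → Set ℝ := fun i => if i ∈ u then {0} else P with hS
  set D : Set EReal := {r | A < 1 ∧
    r ∈ (fun v => ((b v / (1 - A) : ℝ) : EReal)) '' {v | ∀ i, v i ∈ S i}} with hD
  have hsub : B ⊆ ({⊤} ∪ {⊥}) ∪ D := by
    intro r hr
    obtain ⟨p, hp, hrp⟩ := hB hr
    rw [hdiag p] at hrp
    induction r with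
    | bot => simp
    | top => simp
    | coe r =>
      obtain ⟨h1, h2⟩ := eq_div_of_mem_limitPoints hrp hA0
      refine Or.inr ⟨h1, fun i => if h : i ∈ u then 0 else p ⟨i, h⟩, fun i => ?_, by rw [h2]⟩
      by_cases hi : i ∈ u
      · simp [hS, hi]
      · simpa [hS, hi] using hp ⟨i, hi⟩
  have hpos : (0 : Ordinal.{0}) < ω ^ (ot P + 1) := opow_pos _ omega0_pos
  have h1 : (1 : Ordinal.{0}) < ω ^ ω ^ (ot P + 1) :=
    (opow_zero ω).symm.trans_lt ((Ordinal.opow_lt_opow_iff_right one_lt_omega0).2 hpos)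
  have hDlt : OrderTypeLT D (ω ^ ω ^ (ot P + 1)) := by
    by_cases hA1 : A < 1
    · refine ⟨ω ^ naturalSum fun _ : Fin n => ot P, ?_, ?_⟩
      · refine (Ordinal.opow_lt_opow_iff_right one_lt_omega0).2
          (naturalSum_lt_omega0_opow fun _ => ?_)
        exact (lt_add_one _).trans_le (right_le_opow _ one_lt_omega0)
      · refine (OrderTypeLE.image_pi (S := S) (g := fun v => ((b v / (1 - A) : ℝ) : EReal))
          (fun v w h => EReal.coe_le_coe_iff.2
            (div_le_div_of_nonneg_right (hbmono h) (by linarith))) fun i => ?_).mono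
          (fun r hr => hr.2) le_rfl
        by_cases hi : i ∈ u
        · simp only [hS, hi, if_true]
          exact (orderTypeLE_singleton (0 : ℝ)).mono le_rfl
            (Order.one_le_iff_pos.2 (opow_pos _ omega0_pos))
        · simp only [hS, hi, if_false]
          exact orderTypeLE_ot.mono le_rfl (right_le_opow _ one_lt_omega0)
    · exact ⟨0, opow_pos _ omega0_pos,
        (orderTypeLE_empty 0).mono (fun r hr => absurd hr.1 hA1) le_rfl⟩
  have hBlt : OrderTypeLT B (ω ^ ω ^ (ot P + 1)) :=
    (OrderTypeLT.union (OrderTypeLT.union ⟨1, h1, orderTypeLE_singleton _⟩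
      ⟨1, h1, orderTypeLE_singleton _⟩) hDlt).mono hsub le_rfl
  obtain ⟨o, ho, hBo⟩ := hBlt
  simpa [veblen_zero_apply] using hBo.ot_le.trans_lt ho

end Linear

end MonotoneGeneration

theorem mainTheorem3 :
    (∀ (n : ℕ), 2 ≤ n → ∀ (g : (Fin n → ℝ) → ℝ), Monotone g → MonotoneGeneration.IsTame g →
      ∃ _ : WellFoundedLT (MonotoneGeneration.generatedSet {⟨n, g⟩} {0}),
        MonotoneGeneration.ot (MonotoneGeneration.generatedSet {⟨n, g⟩} {0}) ≤
          Ordinal.veblen ((n - 1 : ℕ) : Ordinal) 0) ∧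
    (∀ (n : ℕ) (a : Fin n → ℝ) (C : ℝ), (∀ i, 0 ≤ a i) →
      Monotone (fun x : Fin n → ℝ => (∑ i, a i * x i) + C) ∧
        MonotoneGeneration.IsTame (fun x : Fin n → ℝ => (∑ i, a i * x i) + C)) := by
  refine ⟨fun n hn g hg ht => ?_, fun n a C ha =>
    ⟨MonotoneGeneration.monotone_linear C ha, MonotoneGeneration.isTame_linear C ha⟩⟩
  obtain ⟨m, rfl⟩ := Nat.exists_eq_add_of_le' hn
  have h := MonotoneGeneration.orderTypeLE_generated hg ht
  rw [← MonotoneGeneration.generatedSet_eq_partialGenSet] at h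
  have hwf := h.wellFoundedLT
  exact ⟨hwf, h.ot_le⟩
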